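/- Let $k$ be a field. All graded algebras are $k$-algebras $B=\bigoplus_{i\ge 0}B_i$ with $B_0=k$. Let $B$ be a graded algebra with a decomposition $B=I\oplus C$ (as vector spaces), where $I$ is a homogeneous two-sided ideal and $C$ is a graded subalgebra. Let $B\langle z\rangle$ be the free product over $k$ of $B$ and $k[z]$, with $\deg z=1$, and let $A$ be the graded algebra obtained as the quotient of $B\langle z\rangle$ by the relations $zx=0$ for all $x\in I$ and $zc=cz$ for all $c\in C$. Assume that $I$ is not finitely generated as a right $B$-module. Then $A$ is not right coherent, and for the right ideal $J=zA$ the $k$-vector space $\operatorname{Tor}^A_1(J,k)$ is infinite-dimensional, where $k=A/A_+$ is the trivial left $A$-module and $A_+=\bigoplus_{i>0}A_i$. Here a graded right $A$-module $M$ is called coherent if it is finitely generated and, for every degree-preserving homomorphism $f:P\to M$ with $P$ a finite direct sum of shifts $A(j)$, $j\in\mathbb{Z}$, of the right module $A$, the module $\ker f$ is finitely generated. The algebra $A$ is called right coherent if all the graded right modules $A(j)$ and all the shifts of the trivial right module $k=A/A_+$ are coherent. -/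

import Mathlib

open scoped TensorProduct

namespace GradedCoherence

section FreeAdjoin

variable (k : Type*) [Field k] (B : Type*) [Ring B] [Algebra k B]

/-- Relations, on the free algebra on the symbols `b` (written `some b`, for `b` in `B`) and `z`
(written `none`), that make `b ↦ some b` a homomorphism of unital `k`-algebras. -/
inductive FreeAdjoinRel : FreeAlgebra k (Option B) → FreeAlgebra k (Option B) → Prop
  | scalar (r : k) : FreeAdjoinRel (FreeAlgebra.ι k (some (algebraMap k B r)))
      (algebraMap k (FreeAlgebra k (Option B)) r)
  | add (a b : B) : FreeAdjoinRel (FreeAlgebra.ι k (some (a + b)))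
      (FreeAlgebra.ι k (some a) + FreeAlgebra.ι k (some b))
  | mul (a b : B) : FreeAdjoinRel (FreeAlgebra.ι k (some (a * b)))
      (FreeAlgebra.ι k (some a) * FreeAlgebra.ι k (some b))

/-- `B⟨z⟩`, the free product over `k` of the algebra `B` and the polynomial algebra `k[z]`. -/
def FreeAdjoin := RingQuot (FreeAdjoinRel k B)

noncomputable instance : Ring (FreeAdjoin k B) :=
  inferInstanceAs (Ring (RingQuot (FreeAdjoinRel k B)))

noncomputable instance : Algebra k (FreeAdjoin k B) :=
  inferInstanceAs (Algebra k (RingQuot (FreeAdjoinRel k B)))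

namespace FreeAdjoin

/-- The quotient map onto `B⟨z⟩`. -/
noncomputable def mk : FreeAlgebra k (Option B) →ₐ[k] FreeAdjoin k B :=
  RingQuot.mkAlgHom k (FreeAdjoinRel k B)

variable {k B} in
theorem mk_rel {x y : FreeAlgebra k (Option B)} (h : FreeAdjoinRel k B x y) :
    mk k B x = mk k B y :=
  RingQuot.mkAlgHom_rel k h

/-- The canonical homomorphism from `B` to `B⟨z⟩`. -/
noncomputable def incl : B →ₐ[k] FreeAdjoin k B :=
  AlgHom.ofLinearMap
    { toFun := fun b => mk k B (FreeAlgebra.ι k (some b))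
      map_add' := fun a b => by rw [mk_rel (FreeAdjoinRel.add a b), map_add]
      map_smul' := fun r b => by
        rw [Algebra.smul_def, mk_rel (FreeAdjoinRel.mul _ b), map_mul,
          mk_rel (FreeAdjoinRel.scalar r), AlgHom.commutes, RingHom.id_apply, Algebra.smul_def] }
    (by
      have h := mk_rel (FreeAdjoinRel.scalar (k := k) (B := B) 1)
      simpa using h)
    (fun a b => by
      have h := mk_rel (FreeAdjoinRel.mul (k := k) a b)
      simpa using h)

/-- The element `z` of `B⟨z⟩`. -/
noncomputable def z : FreeAdjoin k B := mk k B (FreeAlgebra.ι k none)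

end FreeAdjoin

end FreeAdjoin

section Extension

variable {k : Type*} [Field k] {B : Type*} [Ring B] [Algebra k B]

/-- The relations `z x = 0` for `x` in `I` and `z c = c z` for `c` in `C`, on `B⟨z⟩`. -/
inductive ExtRel (I : Submodule Bᵐᵒᵖ B) (C : Subalgebra k B) :
    FreeAdjoin k B → FreeAdjoin k B → Prop
  | ideal (x : B) (hx : x ∈ I) :
      ExtRel I C (FreeAdjoin.z k B * FreeAdjoin.incl k B x) 0
  | comm (c : B) (hc : c ∈ C) :
      ExtRel I C (FreeAdjoin.z k B * FreeAdjoin.incl k B c)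
        (FreeAdjoin.incl k B c * FreeAdjoin.z k B)

/-- The algebra `A = B⟨z⟩ / (zI = 0, zc = cz for c in C)`. -/
def Ext (I : Submodule Bᵐᵒᵖ B) (C : Subalgebra k B) := RingQuot (ExtRel I C)

noncomputable instance (I : Submodule Bᵐᵒᵖ B) (C : Subalgebra k B) : Ring (Ext I C) :=
  inferInstanceAs (Ring (RingQuot (ExtRel I C)))

noncomputable instance (I : Submodule Bᵐᵒᵖ B) (C : Subalgebra k B) : Algebra k (Ext I C) :=
  inferInstanceAs (Algebra k (RingQuot (ExtRel I C)))

namespace Ext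

variable (I : Submodule Bᵐᵒᵖ B) (C : Subalgebra k B)

/-- The quotient map from `B⟨z⟩` onto `A`. -/
noncomputable def mk : FreeAdjoin k B →ₐ[k] Ext I C := RingQuot.mkAlgHom k (ExtRel I C)

/-- The canonical homomorphism from `B` to `A`. -/
noncomputable def incl : B →ₐ[k] Ext I C := (mk I C).comp (FreeAdjoin.incl k B)

/-- The image of `z` in `A`. -/
noncomputable def z : Ext I C := mk I C (FreeAdjoin.z k B)

/-- `IsWord ℬ I C n w` says that `w` is a product of homogeneous elements of `B` and of copies
of `z`, of total degree `n`, where `z` has degree `1`. -/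
inductive IsWord (ℬ : ℕ → Submodule k B) : ℕ → Ext I C → Prop
  | one : IsWord ℬ 0 1
  | mul_incl {n : ℕ} {w : Ext I C} (i : ℕ) (b : B) (hb : b ∈ ℬ i) (hw : IsWord ℬ n w) :
      IsWord ℬ (n + i) (w * incl I C b)
  | mul_z {n : ℕ} {w : Ext I C} (hw : IsWord ℬ n w) : IsWord ℬ (n + 1) (w * z I C)

/-- The grading of `A` induced by the grading of `B` and `deg z = 1`. -/
noncomputable def grading (ℬ : ℕ → Submodule k B) (n : ℕ) : Submodule k (Ext I C) :=
  Submodule.span k {w | IsWord I C ℬ n w}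

end Ext

end Extension

section Coherence

variable {k : Type*} [Field k] {A : Type*} [Ring A] [Algebra k A]

/-- Coherence of a graded right `A`-module `M = ⨁ᵢ ℳ i`: it is finitely generated, and the kernel
of every degree-preserving homomorphism `P → M`, with `P` a finite direct sum of shifts of `A`, is
finitely generated. A degree-preserving homomorphism from `P = ⨁ᵢ A(-d i)` is an `A`-linear map
from `Aⁿ` that sends the `i`-th basis vector into `ℳ (d i)`. -/
def IsCoherentModule (A : Type*) [Ring A] {M : Type*} [AddCommGroup M] [Module Aᵐᵒᵖ M]
    (ℳ : ℤ → Set M) : Prop :=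
  Module.Finite Aᵐᵒᵖ M ∧
    ∀ (n : ℕ) (d : Fin n → ℤ) (f : (Fin n → A) →ₗ[Aᵐᵒᵖ] M),
      (∀ i, f (Pi.single i 1) ∈ ℳ (d i)) → (LinearMap.ker f).FG

/-- The graded pieces `A(j)ᵢ = A_{i+j}` of the shift `A(j)`; they vanish for `i + j < 0`. -/
def shiftGrading (𝒜 : ℕ → Submodule k A) (j i : ℤ) : Set A :=
  if 0 ≤ i + j then (𝒜 (i + j).toNat : Set A) else {0}

/-- The augmentation ideal `A₊ = ⨁_{n > 0} Aₙ` as a right ideal. -/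
def augRight (𝒜 : ℕ → Submodule k A) : Submodule Aᵐᵒᵖ A :=
  Submodule.span Aᵐᵒᵖ {a | ∃ n, 0 < n ∧ a ∈ 𝒜 n}

/-- The augmentation ideal `A₊ = ⨁_{n > 0} Aₙ` as a left ideal. -/
def augLeft (𝒜 : ℕ → Submodule k A) : Submodule A A :=
  Submodule.span A {a | ∃ n, 0 < n ∧ a ∈ 𝒜 n}

/-- Right coherence of a connected graded algebra `A`: all the shifted free modules `A(j)` are
coherent, and so are all the shifts of the trivial right module `k = A / A₊`, each concentrated in
a single degree `j`. -/
def IsRightCoherent (𝒜 : ℕ → Submodule k A) : Prop :=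
  (∀ j : ℤ, IsCoherentModule A (shiftGrading 𝒜 j)) ∧
    ∀ j : ℤ, IsCoherentModule A
      (fun i : ℤ => if i = j then (Set.univ : Set (A ⧸ augRight 𝒜)) else {0})

end Coherence

section Tor

variable (k : Type*) [Field k] (A : Type*) [Ring A] [Algebra k A]
  (M : Type*) [AddCommGroup M] [Module k M] [Module Aᵐᵒᵖ M] [IsScalarTower k Aᵐᵒᵖ M]
  (M' : Type*) [AddCommGroup M'] [Module k M'] [Module Aᵐᵒᵖ M'] [IsScalarTower k Aᵐᵒᵖ M']
  (N : Type*) [AddCommGroup N] [Module k N] [Module A N] [IsScalarTower k A N]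

/-- The subspace of `M ⊗ₖ N` spanned by the elements `m a ⊗ n - m ⊗ a n`. -/
def balance : Submodule k (M ⊗[k] N) :=
  Submodule.span k {x | ∃ (m : M) (a : A) (n : N),
    x = (MulOpposite.op a • m) ⊗ₜ[k] n - m ⊗ₜ[k] (a • n)}

/-- The tensor product `M ⊗_A N` of a right `A`-module `M` and a left `A`-module `N`. -/
abbrev TensorOver := (M ⊗[k] N) ⧸ balance k A M N

variable {M M'} in
/-- The map `f ⊗ N : M ⊗_A N → M' ⊗_A N` induced by a homomorphism `f : M → M'` of right
modules. -/
def TensorOver.map (f : M →ₗ[Aᵐᵒᵖ] M') : TensorOver k A M N →ₗ[k] TensorOver k A M' N :=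
  Submodule.mapQ (balance k A M N) (balance k A M' N)
    (LinearMap.rTensor N (f.restrictScalars k)) (by
      rw [balance, Submodule.span_le]
      rintro _ ⟨m, a, n, rfl⟩
      refine Submodule.subset_span ⟨f m, a, n, ?_⟩
      simp)

/-- The canonical surjection onto `M` from the free right `A`-module on the set `M`. -/
noncomputable def freeCover : (M →₀ Aᵐᵒᵖ) →ₗ[Aᵐᵒᵖ] M := Finsupp.linearCombination Aᵐᵒᵖ id

/-- `Tor₁^A(M, N)` for a right `A`-module `M` and a left `A`-module `N`: for the canonical free
presentation `0 → K → F → M → 0`, the kernel of `K ⊗_A N → F ⊗_A N`. -/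
noncomputable def TorOne :
    Submodule k (TensorOver k A (LinearMap.ker (freeCover A M)) N) :=
  LinearMap.ker (TensorOver.map k A N (M' := M →₀ Aᵐᵒᵖ) (LinearMap.ker (freeCover A M)).subtype)

end Tor

end GradedCoherence

/-! Everything rests on the right annihilator of `z`, the kernel of `a ↦ z a` from `A(-1)` onto
`zA`. It contains the image of `I`. Conversely, `A` maps to `(B/I)[X]` with `z ↦ X`; as `X` is a
nonzerodivisor, `z a = 0` kills the image of `a`, whose constant coefficient is the class of
`Ext.proj a`. So `Ext.proj` carries the annihilator onto `I`, and no normal form in `A` is needed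
(`Ext.proj_mem_of_z_mul_eq_zero`).

Finitely many generators of the annihilator would project to generators of `I`, so `A` is not
coherent. For Tor, lifting to `A` and projecting sends syzygies of `zA` into `I` and their multiples
by `A₊` into `I B₊`. The induced map on Tor₁ has image containing `I / I B₊`, which is
infinite-dimensional by graded Nakayama (`fg_of_le_span_sup_mulAug`). -/

namespace GradedCoherence

/-! ### Universal properties of `B⟨z⟩` and `A` -/

section Lift

variable {k : Type*} [Field k] {B : Type*} [Ring B] [Algebra k B]
  {D : Type*} [Ring D] [Algebra k D]

/-- The homomorphism on `B⟨z⟩` that extends `f : B → D` and sends `z` to `d`. -/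
noncomputable def FreeAdjoin.lift (f : B →ₐ[k] D) (d : D) : FreeAdjoin k B →ₐ[k] D :=
  RingQuot.liftAlgHom k (s := FreeAdjoinRel k B)
    ⟨FreeAlgebra.lift k (fun o : Option B => o.elim d f), by
      intro x y h
      induction h <;> simp⟩

theorem FreeAdjoin.lift_mk (f : B →ₐ[k] D) (d : D) (x : FreeAlgebra k (Option B)) :
    FreeAdjoin.lift f d (FreeAdjoin.mk k B x) =
      FreeAlgebra.lift k (fun o : Option B => o.elim d f) x :=
  RingQuot.liftAlgHom_mkAlgHom_apply k _ _ x

theorem FreeAdjoin.lift_incl (f : B →ₐ[k] D) (d : D) (b : B) :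
    FreeAdjoin.lift f d (FreeAdjoin.incl k B b) = f b := by
  refine (FreeAdjoin.lift_mk f d _).trans ?_
  simp

theorem FreeAdjoin.lift_z (f : B →ₐ[k] D) (d : D) :
    FreeAdjoin.lift f d (FreeAdjoin.z k B) = d := by
  refine (FreeAdjoin.lift_mk f d _).trans ?_
  simp

variable {I : Submodule Bᵐᵒᵖ B} {C : Subalgebra k B}

/-- The universal property of `A = B⟨z⟩ / (zI = 0, zc = cz)`. -/
noncomputable def Ext.lift (f : B →ₐ[k] D) (d : D) (hI : ∀ x ∈ I, d * f x = 0)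
    (hC : ∀ c ∈ C, d * f c = f c * d) : Ext I C →ₐ[k] D :=
  RingQuot.liftAlgHom k (s := ExtRel I C)
    ⟨FreeAdjoin.lift f d, by
      intro x y h
      induction h with
      | ideal x hx => simp [FreeAdjoin.lift_incl, FreeAdjoin.lift_z, hI x hx]
      | comm c hc => simp [FreeAdjoin.lift_incl, FreeAdjoin.lift_z, hC c hc]⟩

variable (f : B →ₐ[k] D) (d : D) (hI : ∀ x ∈ I, d * f x = 0) (hC : ∀ c ∈ C, d * f c = f c * d)

theorem Ext.lift_incl (b : B) : Ext.lift f d hI hC (Ext.incl I C b) = f b :=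
  (RingQuot.liftAlgHom_mkAlgHom_apply k _ _ _).trans (FreeAdjoin.lift_incl f d b)

theorem Ext.lift_z : Ext.lift f d hI hC (Ext.z I C) = d :=
  (RingQuot.liftAlgHom_mkAlgHom_apply k _ _ _).trans (FreeAdjoin.lift_z f d)

theorem Ext.z_mul_incl {x : B} (hx : x ∈ I) : Ext.z I C * Ext.incl I C x = 0 := by
  have h := RingQuot.mkAlgHom_rel k (ExtRel.ideal (C := C) x hx)
  rw [map_mul, map_zero] at h
  exact h

end Lift

/-! ### The projection `A → B` and the annihilator of `z` -/

section Projection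

variable {k : Type*} [Field k] {B : Type*} [Ring B] [Algebra k B]
  (I : Submodule Bᵐᵒᵖ B) (C : Subalgebra k B)

variable {I C} in
theorem Ext.ringHom_ext {D : Type*} [Ring D] {f g : Ext I C →+* D}
    (h : ∀ b, f (Ext.incl I C b) = g (Ext.incl I C b)) (hz : f (Ext.z I C) = g (Ext.z I C)) :
    f = g := by
  ext a
  obtain ⟨a, rfl⟩ := RingQuot.mkAlgHom_surjective k (ExtRel I C) a
  obtain ⟨a, rfl⟩ := RingQuot.mkAlgHom_surjective k (FreeAdjoinRel k B) a
  change f (Ext.mk I C (FreeAdjoin.mk k B a)) = g (Ext.mk I C (FreeAdjoin.mk k B a))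
  induction a with
  | grade0 r => simpa using h (algebraMap k B r)
  | grade1 o =>
    cases o with
    | none => exact hz
    | some b => exact h b
  | mul a b ha hb => simp only [map_mul, ha, hb]
  | add a b ha hb => simp only [map_add, ha, hb]

/-- The projection `A → B` that sends `z` to `0`. -/
noncomputable def Ext.proj : Ext I C →ₐ[k] B :=
  Ext.lift (AlgHom.id k B) 0 (by simp) (by simp)

variable {I C}

@[simp]
theorem Ext.proj_incl (b : B) : Ext.proj I C (Ext.incl I C b) = b := Ext.lift_incl ..

@[simp]
theorem Ext.proj_z : Ext.proj I C (Ext.z I C) = 0 := Ext.lift_z ..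

/-- A right ideal stable under left multiplication, as a left ideal. -/
def leftIdeal (I : Submodule Bᵐᵒᵖ B) (hI : ∀ b x : B, x ∈ I → b * x ∈ I) : Ideal B where
  carrier := I
  add_mem' := I.add_mem
  zero_mem' := I.zero_mem
  smul_mem' b x hx := hI b x hx

theorem Ext.proj_mem_of_z_mul_eq_zero (hI : ∀ b x : B, x ∈ I → b * x ∈ I) {a : Ext I C}
    (ha : Ext.z I C * a = 0) : Ext.proj I C a ∈ I := by
  let L := leftIdeal I hI
  have : L.IsTwoSided := ⟨fun {x} b hx => I.smul_mem (MulOpposite.op b) hx⟩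
  let f : B →ₐ[k] Polynomial (B ⧸ L) := Polynomial.CAlgHom.comp (Ideal.Quotient.mkₐ k L)
  have hf (b : B) : f b = Polynomial.C (Ideal.Quotient.mk L b) := rfl
  let g : Ext I C →ₐ[k] Polynomial (B ⧸ L) := Ext.lift f Polynomial.X
    (fun x hx => by rw [hf, Ideal.Quotient.eq_zero_iff_mem.mpr (show x ∈ L from hx)]; simp)
    (fun c _ => Polynomial.X_mul)
  -- Setting `X = 0` after `g` agrees with setting `z = 0` and then reducing modulo `I`.
  have hg : (Polynomial.constantCoeff.comp (g : Ext I C →+* _)) =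
      (Ideal.Quotient.mk L).comp (Ext.proj I C : Ext I C →+* B) := by
    refine Ext.ringHom_ext (fun b => ?_) ?_
    · simp [g, Ext.lift_incl, hf]
    · simp [g, Ext.lift_z]
  have hga : g a = 0 := by
    have h := congrArg g ha
    rwa [map_mul, map_zero, show g (Ext.z I C) = Polynomial.X from Ext.lift_z ..,
      Polynomial.monic_X.mul_right_eq_zero_iff] at h
  have h := DFunLike.congr_fun hg a
  simp only [RingHom.comp_apply, RingHom.coe_coe, hga, map_zero] at h
  exact Ideal.Quotient.eq_zero_iff_mem.mp h.symm

variable {ℬ : ℕ → Submodule k B}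

theorem Ext.z_mem_grading : Ext.z I C ∈ Ext.grading I C ℬ 1 := by
  have h := Ext.IsWord.mul_z (Ext.IsWord.one (I := I) (C := C) (ℬ := ℬ))
  rw [one_mul] at h
  exact Submodule.subset_span h

theorem Ext.incl_mem_grading {n : ℕ} {b : B} (hb : b ∈ ℬ n) :
    Ext.incl I C b ∈ Ext.grading I C ℬ n := by
  have h := Ext.IsWord.mul_incl n b hb (Ext.IsWord.one (I := I) (C := C) (ℬ := ℬ))
  rw [one_mul, zero_add] at h
  exact Submodule.subset_span h

theorem Ext.proj_mem_of_isWord [SetLike.GradedMonoid ℬ] {n : ℕ} {w : Ext I C}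
    (hw : Ext.IsWord I C ℬ n w) : Ext.proj I C w ∈ ℬ n := by
  induction hw with
  | one => simpa using SetLike.GradedOne.one_mem
  | mul_incl i b hb _ ih => simpa using SetLike.mul_mem_graded ih hb
  | mul_z _ _ => simp

theorem Ext.proj_mem [SetLike.GradedMonoid ℬ] {n : ℕ} {a : Ext I C}
    (ha : a ∈ Ext.grading I C ℬ n) : Ext.proj I C a ∈ ℬ n := by
  have h : Ext.grading I C ℬ n ≤ (ℬ n).comap (Ext.proj I C).toLinearMap :=
    Submodule.span_le.mpr fun w hw => Ext.proj_mem_of_isWord hw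
  exact h ha

end Projection

/-! ### Graded Nakayama lemma -/

section GradedNakayama

variable {k : Type*} [Field k] {B : Type*} [Ring B] [Algebra k B] (ℬ : ℕ → Submodule k B)

/-- The subspace `I B₊`. -/
def mulAug (I : Submodule Bᵐᵒᵖ B) : Submodule k B :=
  Submodule.span k {x | ∃ y ∈ I, ∃ n, 0 < n ∧ ∃ b ∈ ℬ n, x = y * b}

/-- Graded Nakayama lemma: a homogeneous right ideal `I` that is spanned by finitely many elements
modulo `I B₊` is finitely generated. -/
theorem fg_of_le_span_sup_mulAug [GradedAlgebra ℬ] {I : Submodule Bᵐᵒᵖ B}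
    (hIhom : ∀ x ∈ I, ∀ n : ℕ, (DirectSum.decompose ℬ x n : B) ∈ I) {S : Set B} (hS : S.Finite)
    (hSI : S ⊆ I) (h : I.restrictScalars k ≤ Submodule.span k S ⊔ mulAug ℬ I) : I.FG := by
  classical
  let T : Set B := ⋃ s ∈ S, ⋃ n ∈ (DirectSum.decompose ℬ s).support,
    {(DirectSum.decompose ℬ s n : B)}
  have hT : T.Finite := hS.biUnion fun s _ => (Finset.finite_toSet _).biUnion fun _ _ =>
    Set.finite_singleton _
  refine Submodule.fg_def.mpr ⟨T, hT, le_antisymm ?_ ?_⟩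
  · refine Submodule.span_le.mpr fun t ht => ?_
    simp only [T, Set.mem_iUnion, Set.mem_singleton_iff] at ht
    obtain ⟨s, hs, n, -, rfl⟩ := ht
    exact hIhom s (hSI hs) n
  · set N := Submodule.span Bᵐᵒᵖ T with hN
    -- Induction on the degree: for `b` of degree `m > 0`, the degree `n` part of `y * b` is
    -- `y_{n-m} * b`, and `n - m < n`.
    have hcomp (n : ℕ) : ∀ x ∈ I, (DirectSum.decompose ℬ x n : B) ∈ N := by
      induction n using Nat.strong_induction_on with
      | _ n ih =>
        intro x hx
        let p : B →ₗ[k] B := GradedAlgebra.proj ℬ n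
        have hp (y : B) : p y = (DirectSum.decompose ℬ y n : B) := GradedAlgebra.proj_apply ..
        have hle : Submodule.span k S ⊔ mulAug ℬ I ≤ (N.restrictScalars k).comap p := by
          refine sup_le (Submodule.span_le.mpr fun s hs => ?_) (Submodule.span_le.mpr ?_)
          · change p s ∈ N
            rw [hp]
            by_cases h0 : DirectSum.decompose ℬ s n = 0
            · rw [h0]; exact N.zero_mem
            · refine Submodule.subset_span ?_
              simp only [T, Set.mem_iUnion, Set.mem_singleton_iff]
              exact ⟨s, hs, n, DFinsupp.mem_support_iff.mpr h0, rfl⟩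
          · rintro _ ⟨y, hy, m, hm, b, hb, rfl⟩
            change p (y * b) ∈ N
            rw [hp]
            by_cases hmn : m ≤ n
            · rw [DirectSum.coe_decompose_mul_of_right_mem_of_le ℬ hb hmn]
              exact N.smul_mem (MulOpposite.op b) (ih (n - m) (by omega) y hy)
            · rw [DirectSum.coe_decompose_mul_of_right_mem_of_not_le ℬ hb hmn]
              exact N.zero_mem
        have := hle (h hx)
        rwa [Submodule.mem_comap, hp] at this
    intro x hx
    rw [← DirectSum.sum_support_decompose ℬ x]
    exact N.sum_mem fun n _ => hcomp n x hx

end GradedNakayama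

/-! ### Tensor products and Tor with coefficients in `A / L` -/

section TensorQuotient

variable {k : Type*} [Field k] {A : Type*} [Ring A] [Algebra k A]
  {M : Type*} [AddCommGroup M] [Module k M] [Module Aᵐᵒᵖ M] [IsScalarTower k Aᵐᵒᵖ M]
  {W : Type*} [AddCommGroup W] [Module k W]

variable (k A) in
/-- The class of `m ⊗ n` in `M ⊗_A N`. -/
def TensorOver.tmul {N : Type*} [AddCommGroup N] [Module k N] [Module A N] (m : M) (n : N) :
    TensorOver k A M N :=
  (balance k A M N).mkQ (m ⊗ₜ[k] n)

/-- A linear map on `M` that vanishes on `M L`, for a left ideal `L` of `A`, induces a linear map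
on `M ⊗_A (A / L)`. -/
theorem exists_tensorOver_quotient_lift (L : Submodule A A) (ψ : M →ₗ[k] W)
    (hψ : ∀ v, ∀ a ∈ L, ψ (MulOpposite.op a • v) = 0) :
    ∃ Ψ : TensorOver k A M (A ⧸ L) →ₗ[k] W, ∀ v a,
      Ψ (TensorOver.tmul k A v (Submodule.Quotient.mk a)) =
        ψ (MulOpposite.op a • v) := by
  let P (v : M) : (A ⧸ L) →ₗ[k] W :=
    { toFun := Quotient.lift (fun a : A => ψ (MulOpposite.op a • v)) (fun a b hab => by
        have h := hψ v _ ((Submodule.quotientRel_def L).mp hab)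
        rwa [MulOpposite.op_sub, sub_smul, map_sub, sub_eq_zero] at h)
      map_add' := by
        rintro ⟨a⟩ ⟨b⟩
        change ψ (MulOpposite.op (a + b) • v) =
          ψ (MulOpposite.op a • v) + ψ (MulOpposite.op b • v)
        rw [MulOpposite.op_add, add_smul, map_add]
      map_smul' := by
        rintro r ⟨a⟩
        change ψ (MulOpposite.op (r • a) • v) = r • ψ (MulOpposite.op a • v)
        rw [MulOpposite.op_smul, smul_assoc, map_smul] }
  have hP (v : M) (a : A) : P v (Submodule.Quotient.mk a) = ψ (MulOpposite.op a • v) := rfl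
  -- The two actions commute because scalars are central in `A`.
  have hcomm (r : k) (a : Aᵐᵒᵖ) (v : M) : a • r • v = r • a • v := by
    rw [← algebraMap_smul Aᵐᵒᵖ r v, ← algebraMap_smul Aᵐᵒᵖ r (a • v), smul_smul, smul_smul,
      Algebra.commutes]
  let Ψ₀ : M →ₗ[k] (A ⧸ L) →ₗ[k] W :=
    { toFun := P
      map_add' := fun v w => by
        refine LinearMap.ext fun n => ?_
        obtain ⟨a, rfl⟩ := Submodule.Quotient.mk_surjective _ n
        rw [LinearMap.add_apply, hP, hP, hP, smul_add, map_add]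
      map_smul' := fun r v => by
        refine LinearMap.ext fun n => ?_
        obtain ⟨a, rfl⟩ := Submodule.Quotient.mk_surjective _ n
        rw [RingHom.id_apply, LinearMap.smul_apply, hP, hP, hcomm, map_smul] }
  refine ⟨(balance k A M (A ⧸ L)).liftQ (TensorProduct.lift Ψ₀) ?_, fun v a => rfl⟩
  rw [balance, Submodule.span_le]
  rintro _ ⟨v, a, n, rfl⟩
  obtain ⟨b, rfl⟩ := Submodule.Quotient.mk_surjective _ n
  change TensorProduct.lift Ψ₀ _ = 0
  rw [map_sub, TensorProduct.lift.tmul, TensorProduct.lift.tmul, sub_eq_zero]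
  change ψ (MulOpposite.op b • MulOpposite.op a • v) = ψ (MulOpposite.op (a * b) • v)
  rw [smul_smul, MulOpposite.op_mul]

omit [IsScalarTower k Aᵐᵒᵖ M] in
variable (k) in
theorem TensorOver.smul_tmul_mk_one {L : Submodule A A} (v : M) {a : A} (ha : a ∈ L) :
    TensorOver.tmul k A (MulOpposite.op a • v) (Submodule.Quotient.mk 1 : A ⧸ L) = 0 := by
  have h : (MulOpposite.op a • v) ⊗ₜ[k] (Submodule.Quotient.mk 1 : A ⧸ L) -
      v ⊗ₜ[k] (a • (Submodule.Quotient.mk 1 : A ⧸ L)) ∈ balance k A M (A ⧸ L) :=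
    Submodule.subset_span ⟨v, a, _, rfl⟩
  rw [← Submodule.Quotient.mk_smul, smul_eq_mul, mul_one, (Submodule.Quotient.mk_eq_zero L).mpr ha,
    TensorProduct.tmul_zero, sub_zero] at h
  exact (Submodule.Quotient.mk_eq_zero _).mpr h

omit [Module k M] [IsScalarTower k Aᵐᵒᵖ M] in
/-- The class in `Tor₁^A(M, A / L)` of a syzygy of the form `e a` with `a` in `L`. -/
theorem mk_tmul_mem_torOne {L : Submodule A A} (v : LinearMap.ker (freeCover A M))
    (e : M →₀ Aᵐᵒᵖ) {a : A} (ha : a ∈ L) (hv : (v : M →₀ Aᵐᵒᵖ) = MulOpposite.op a • e) :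
    TensorOver.tmul k A v (Submodule.Quotient.mk 1 : A ⧸ L) ∈ TorOne k A M (A ⧸ L) := by
  rw [TorOne, LinearMap.mem_ker]
  refine Eq.trans ?_ (TensorOver.smul_tmul_mk_one k e ha)
  rw [← hv]
  rfl

end TensorQuotient

/-! ### Failure of coherence and infinite-dimensional Tor -/

section Main

variable {k : Type*} [Field k] {B : Type*} [Ring B] [Algebra k B]
  {I : Submodule Bᵐᵒᵖ B} {C : Subalgebra k B}

theorem not_isRightCoherent (ℬ : ℕ → Submodule k B) (hI : ∀ b x : B, x ∈ I → b * x ∈ I)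
    (hnfg : ¬ I.FG) : ¬ IsRightCoherent (Ext.grading I C ℬ) := by
  rintro ⟨hcoh, -⟩
  let f : (Fin 1 → Ext I C) →ₗ[(Ext I C)ᵐᵒᵖ] Ext I C :=
    { toFun := fun v => Ext.z I C * v 0
      map_add' := fun v w => mul_add _ _ _
      map_smul' := fun a v => (mul_assoc _ (v 0) a.unop).symm }
  have hf (v : Fin 1 → Ext I C) : f v = Ext.z I C * v 0 := rfl
  -- The basis vector goes to `z`, of degree `1`; hence the shift `1`.
  obtain ⟨S, hS⟩ := (hcoh 0).2 1 (fun _ => 1) f (fun i => by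
    rw [Subsingleton.elim i 0, hf, Pi.single_eq_same, mul_one]
    simpa [shiftGrading] using Ext.z_mem_grading)
  let φ : (Fin 1 → Ext I C) → B := fun v => Ext.proj I C (v 0)
  refine hnfg (Submodule.fg_def.mpr ⟨φ '' S, S.finite_toSet.image φ, le_antisymm ?_ ?_⟩)
  · refine Submodule.span_le.mpr ?_
    rintro _ ⟨v, hv, rfl⟩
    have hv' : v ∈ LinearMap.ker f := hS ▸ Submodule.subset_span hv
    exact Ext.proj_mem_of_z_mul_eq_zero hI hv'
  · intro x hx
    have hmem : (fun _ => Ext.incl I C x : Fin 1 → Ext I C) ∈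
        Submodule.span (Ext I C)ᵐᵒᵖ (S : Set (Fin 1 → Ext I C)) :=
      hS ▸ Ext.z_mul_incl hx
    have hφ (v) (hv : v ∈ Submodule.span (Ext I C)ᵐᵒᵖ (S : Set (Fin 1 → Ext I C))) :
        φ v ∈ Submodule.span Bᵐᵒᵖ (φ '' S) := by
      induction hv using Submodule.span_induction with
      | mem v hv => exact Submodule.subset_span ⟨v, hv, rfl⟩
      | zero => simp [φ]
      | add v w _ _ hv hw => simpa [φ] using Submodule.add_mem _ hv hw
      | smul a v _ hv =>
        have h := Submodule.smul_mem _ (MulOpposite.op (Ext.proj I C a.unop)) hv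
        simpa [φ] using h
    simpa [φ] using hφ _ hmem

/-- A homogeneous two-sided ideal that is not finitely generated has no component in degree `0`. -/
theorem decompose_zero_eq_zero {ℬ : ℕ → Submodule k B} [GradedAlgebra ℬ] (hconn : ℬ 0 = 1)
    (hIhom : ∀ x ∈ I, ∀ n : ℕ, (DirectSum.decompose ℬ x n : B) ∈ I) (hnfg : ¬ I.FG)
    {x : B} (hx : x ∈ I) : (DirectSum.decompose ℬ x 0 : B) = 0 := by
  by_contra h0
  obtain ⟨r, hr⟩ := Submodule.mem_one.mp (hconn.le (SetLike.coe_mem (DirectSum.decompose ℬ x 0)))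
  have hr0 : r ≠ 0 := by
    rintro rfl
    exact h0 (by rw [← hr, map_zero])
  -- A nonzero component in `ℬ 0 = k` is invertible, so `I = B`, which is generated by `1`.
  have h1 : (1 : B) ∈ I := by
    have h := I.smul_mem (MulOpposite.op (algebraMap k B r⁻¹)) (hIhom x hx 0)
    rwa [← hr, MulOpposite.smul_eq_mul_unop, MulOpposite.unop_op, ← map_mul,
      mul_inv_cancel₀ hr0, map_one] at h
  refine hnfg (Submodule.fg_def.mpr ⟨{1}, Set.finite_singleton _, le_antisymm ?_ ?_⟩)
  · exact Submodule.span_le.mpr (Set.singleton_subset_iff.mpr h1)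
  · intro y _
    have h := Submodule.smul_mem _ (MulOpposite.op y)
      (Submodule.mem_span_singleton_self (R := Bᵐᵒᵖ) (1 : B))
    simpa using h

/-- Left multipliers in `A₊` are harmless: `y (c a) = (y c) a`, and `y c` stays in the right ideal
`I`. Hence the induction has to vary `y`. -/
theorem mul_proj_mem_mulAug {ℬ : ℕ → Submodule k B} [GradedAlgebra ℬ] {y : B} (hy : y ∈ I)
    {a : Ext I C} (ha : a ∈ augLeft (Ext.grading I C ℬ)) :
    y * Ext.proj I C a ∈ mulAug ℬ I := by
  induction ha using Submodule.span_induction generalizing y with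
  | mem a ha =>
    obtain ⟨n, hn, ha⟩ := ha
    exact Submodule.subset_span ⟨y, hy, n, hn, _, Ext.proj_mem ha, rfl⟩
  | zero => simp
  | add a b _ _ iha ihb => simpa [mul_add] using Submodule.add_mem _ (iha hy) (ihb hy)
  | smul c a _ ih =>
    have h := ih (I.smul_mem (MulOpposite.op (Ext.proj I C c)) hy)
    simpa [mul_assoc] using h

theorem incl_mem_augLeft {ℬ : ℕ → Submodule k B} [GradedAlgebra ℬ] {x : B}
    (hx : (DirectSum.decompose ℬ x 0 : B) = 0) :
    Ext.incl I C x ∈ augLeft (Ext.grading I C ℬ) := by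
  classical
  rw [← DirectSum.sum_support_decompose ℬ x, map_sum]
  refine Submodule.sum_mem _ fun n hn => ?_
  have hn0 : 0 < n := Nat.pos_of_ne_zero (by
    rintro rfl
    exact DFinsupp.mem_support_iff.mp hn (Subtype.ext hx))
  exact Submodule.subset_span ⟨n, hn0, Ext.incl_mem_grading (SetLike.coe_mem _)⟩

variable (I C) in
/-- The right ideal `J = zA`. -/
noncomputable abbrev zIdeal : Submodule (Ext I C)ᵐᵒᵖ (Ext I C) := Submodule.span (Ext I C)ᵐᵒᵖ {Ext.z I C}

/-- A lift to `A` of the canonical free cover of `zA` along multiplication by `z`. -/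
theorem exists_lift_freeCover : ∃ s : (zIdeal I C →₀ (Ext I C)ᵐᵒᵖ) →ₗ[(Ext I C)ᵐᵒᵖ] Ext I C,
    (∀ v, Ext.z I C * s v = freeCover (Ext I C) (zIdeal I C) v) ∧
    ∀ a, s (Finsupp.single ⟨Ext.z I C, Submodule.mem_span_singleton_self _⟩ (MulOpposite.op a))
      = a := by
  classical
  have hex (j : zIdeal I C) : ∃ a, Ext.z I C * a = j := by
    obtain ⟨a, ha⟩ := Submodule.mem_span_singleton.mp j.2
    exact ⟨a.unop, ha⟩
  choose c hc using hex
  let z' : zIdeal I C := ⟨Ext.z I C, Submodule.mem_span_singleton_self _⟩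
  -- The choice at `z` is forced to be `1`, so that `s` recovers `a` from the basis vector of `z`
  -- times `a`.
  let c' := Function.update c z' 1
  have hc' (j : zIdeal I C) : Ext.z I C * c' j = j := by
    by_cases hj : j = z'
    · subst hj; simp [c', z']
    · simp [c', hj, hc]
  refine ⟨Finsupp.linearCombination _ c', fun v => ?_, fun a => ?_⟩
  · induction v using Finsupp.induction_linear with
    | zero => simp
    | add v w hv hw => simp [mul_add, hv, hw]
    | single j a => simp [freeCover, ← mul_assoc, hc']
  · change Finsupp.linearCombination _ c' (Finsupp.single z' _) = a
    simp [c']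

theorem not_finiteDimensional_torOne {ℬ : ℕ → Submodule k B} [GradedAlgebra ℬ]
    (hconn : ℬ 0 = 1) (hI : ∀ b x : B, x ∈ I → b * x ∈ I)
    (hIhom : ∀ x ∈ I, ∀ n : ℕ, (DirectSum.decompose ℬ x n : B) ∈ I) (hnfg : ¬ I.FG) :
    ¬ FiniteDimensional k (TorOne k (Ext I C) (Submodule.span (Ext I C)ᵐᵒᵖ {Ext.z I C})
      (Ext I C ⧸ augLeft (Ext.grading I C ℬ))) := by
  intro hfin
  obtain ⟨s, hs, hsz⟩ := exists_lift_freeCover (I := I) (C := C)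
  let K := LinearMap.ker (freeCover (Ext I C) (zIdeal I C))
  let L := augLeft (Ext.grading I C ℬ)
  have hsI (v : K) : Ext.proj I C (s v) ∈ I :=
    Ext.proj_mem_of_z_mul_eq_zero hI (by rw [hs, v.2]; rfl)
  let ψ : K →ₗ[k] B ⧸ mulAug ℬ I := (mulAug ℬ I).mkQ ∘ₗ (Ext.proj I C).toLinearMap ∘ₗ
    (s.restrictScalars k) ∘ₗ (K.subtype.restrictScalars k)
  have hψ (v : K) : ψ v = (mulAug ℬ I).mkQ (Ext.proj I C (s v)) := rfl
  obtain ⟨Ψ, hΨ⟩ := exists_tensorOver_quotient_lift (M := K) L ψ (fun v a ha => by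
    rw [hψ, Submodule.coe_smul, map_smul, MulOpposite.smul_eq_mul_unop, MulOpposite.unop_op,
      map_mul, Submodule.mkQ_apply, Submodule.Quotient.mk_eq_zero]
    exact mul_proj_mem_mulAug (hsI v) ha)
  have hle : (I.restrictScalars k).map (mulAug ℬ I).mkQ ≤
      (TorOne k (Ext I C) (zIdeal I C) (Ext I C ⧸ L)).map Ψ := by
    rintro _ ⟨x, hx, rfl⟩
    let z' : zIdeal I C := ⟨Ext.z I C, Submodule.mem_span_singleton_self _⟩
    let v : zIdeal I C →₀ (Ext I C)ᵐᵒᵖ := Finsupp.single z' (MulOpposite.op (Ext.incl I C x))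
    have hv : v ∈ K := by
      refine LinearMap.mem_ker.mpr (Subtype.ext ?_)
      rw [← hs, hsz]
      exact Ext.z_mul_incl hx
    -- With `e` the basis vector of `z`, the syzygy `e x` gives a Tor class: in the free module `e x
    -- ⊗ 1 = e ⊗ x = 0`, since `x` lies in `A₊`.
    refine ⟨_, mk_tmul_mem_torOne ⟨v, hv⟩ (Finsupp.single z' 1)
      (incl_mem_augLeft (decompose_zero_eq_zero hconn hIhom hnfg hx)) ?_, ?_⟩
    · rw [Finsupp.smul_single, smul_eq_mul, mul_one]
    · rw [hΨ, MulOpposite.op_one, one_smul, hψ, hsz, Ext.proj_incl]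
  have : FiniteDimensional k ((TorOne k (Ext I C) (zIdeal I C) (Ext I C ⧸ L)).map Ψ) :=
    inferInstance
  have hfg : ((I.restrictScalars k).map (mulAug ℬ I).mkQ).FG :=
    Module.Finite.iff_fg.mp (Submodule.finiteDimensional_of_le hle)
  obtain ⟨T, hT, hspan⟩ := Submodule.fg_def.mp hfg
  -- Generators of `I` modulo `I B₊` are lifted to elements of `I`, as Nakayama requires.
  obtain ⟨S, hSI, hS, rfl⟩ := Set.exists_subset_image_finite_and.mp
    ⟨T, (hspan ▸ Submodule.subset_span : T ⊆ _), hT, rfl⟩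
  refine hnfg (fg_of_le_span_sup_mulAug ℬ hIhom hS hSI ?_)
  have h := Submodule.map_le_iff_le_comap.mp hspan.ge
  rwa [← Submodule.map_span, Submodule.comap_map_eq, Submodule.ker_mkQ] at h

end Main

end GradedCoherence

open GradedCoherence in
theorem mainTheorem10 {k : Type*} [Field k] {B : Type*} [Ring B] [Nontrivial B] [Algebra k B]
    (ℬ : ℕ → Submodule k B) [GradedAlgebra ℬ] (hconn : ℬ 0 = 1)
    (I : Submodule Bᵐᵒᵖ B) (C : Subalgebra k B)
    (hIleft : ∀ (b x : B), x ∈ I → b * x ∈ I)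
    (hIhom : ∀ x ∈ I, ∀ n : ℕ, (DirectSum.decompose ℬ x n : B) ∈ I)
    (hChom : ∀ c ∈ C, ∀ n : ℕ, (DirectSum.decompose ℬ c n : B) ∈ C)
    (hdecomp : IsCompl (I.restrictScalars k) (Subalgebra.toSubmodule C))
    (hnfg : ¬ I.FG) :
    ¬ IsRightCoherent (Ext.grading I C ℬ) ∧
      ¬ FiniteDimensional k
        (TorOne k (Ext I C) (Submodule.span (Ext I C)ᵐᵒᵖ {Ext.z I C})
          (Ext I C ⧸ augLeft (Ext.grading I C ℬ))) :=
  ⟨not_isRightCoherent ℬ hIleft hnfg, not_finiteDimensional_torOne hconn hIleft hIhom hnfg⟩
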